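/- Let $\mathbb F$ be a field. For a natural number $n$, regard the space $M_n(\mathbb F)$ of $n\times n$ matrices as equipped with two multiplications: the matrix product (with identity $I$) and the entrywise (Hadamard) product $\circ$ (with identity the all-one matrix $J$). A double subalgebra of $M_n(\mathbb F)$ is a linear subspace that is closed under both products and contains both $I$ and $J$. For a graph $G$ with vertex set $\{1,\dots,n\}$ and adjacency matrix $A_G \in M_n(\mathbb F)$, let $\mathbb F\langle\langle A_G\rangle\rangle$ be the smallest double subalgebra of $M_n(\mathbb F)$ that contains $A_G$. Then, for the Erdős–Rényi random graph $G(n,\tfrac12)$, $\mathbb F\langle\langle A_G\rangle\rangle = M_n(\mathbb F)$ asymptotically almost surely, that is, $$\lim_{n\to\infty}\Pr_{G\sim G(n,1/2)}\bigl[\mathbb F\langle\langle A_G\rangle\rangle = M_n(\mathbb F)\bigr]=1 .$$ -/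

import Mathlib

open scoped Matrix

/-- A double subalgebra of the double algebra `M_V(F)` of square matrices over `F`, whose two
unital associative multiplications are the matrix product (with identity `1`) and the entrywise
product `⊙` (with identity the all-one matrix): a linear subspace which is closed under both
multiplications and contains both identities. -/
structure DoubleSubalgebra (F V : Type*) [Field F] [Fintype V] [DecidableEq V]
    extends Subalgebra F (Matrix V V F) where
  allOne_mem' : (Matrix.of fun _ _ => 1) ∈ carrier
  hadamard_mem' : ∀ {a b : Matrix V V F}, a ∈ carrier → b ∈ carrier → a ⊙ b ∈ carrier

namespace DoubleSubalgebra

/-- The double subalgebra `F⟨⟨a⟩⟩` generated by `a`: the intersection of all double subalgebras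
which contain `a`. -/
def adjoin (F : Type*) {V : Type*} [Field F] [Fintype V] [DecidableEq V] (a : Matrix V V F) :
    DoubleSubalgebra F V where
  carrier := {x | ∀ S : DoubleSubalgebra F V, a ∈ S.toSubalgebra → x ∈ S.toSubalgebra}
  mul_mem' hx hy S hS := mul_mem (hx S hS) (hy S hS)
  add_mem' hx hy S hS := add_mem (hx S hS) (hy S hS)
  algebraMap_mem' r S _ := S.toSubalgebra.algebraMap_mem r
  allOne_mem' S _ := S.allOne_mem'
  hadamard_mem' hx hy S hS := S.hadamard_mem' (hx S hS) (hy S hS)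

/-- `F⟨⟨a⟩⟩` contains `a`. -/
theorem self_mem_adjoin {F V : Type*} [Field F] [Fintype V] [DecidableEq V]
    (a : Matrix V V F) : a ∈ (adjoin F a).toSubalgebra :=
  fun _ hS => hS

/-- `F⟨⟨a⟩⟩` is the smallest double subalgebra which contains `a`. -/
theorem adjoin_le {F V : Type*} [Field F] [Fintype V] [DecidableEq V]
    {a : Matrix V V F} {S : DoubleSubalgebra F V} (hS : a ∈ S.toSubalgebra) :
    (adjoin F a).toSubalgebra ≤ S.toSubalgebra :=
  fun _ hx => hx S hS

end DoubleSubalgebra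

open scoped Classical in
/-- The double algebra `F⟨⟨A_G⟩⟩` of a finite graph `G`: the double subalgebra of the matrix double
algebra which is generated by the adjacency matrix of `G`. -/
noncomputable def SimpleGraph.doubleAlgebra (F : Type*) {V : Type*} [Field F] [Fintype V]
    [DecidableEq V] (G : SimpleGraph V) : DoubleSubalgebra F V :=
  DoubleSubalgebra.adjoin F (G.adjMatrix F)

/-!
The double algebra of a graph `G` is not the full matrix algebra only if `G` has a nontrivial
partition that is *equitable over `F`*: any two vertices of a cell have the same number of neighbours
in each cell, as elements of `F`. Indeed, the diagonal matrices in the double algebra form an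
algebra of functions on the vertices. It is closed under multiplication of vectors by the adjacency
matrix, and by interpolation it contains the indicators of the classes of vertices which it does not
separate, so these classes form an equitable partition (`SimpleGraph.exists_isEquitable`). If all
classes are singletons, then the double algebra contains all diagonal matrix units `e_vv`, hence
all matrix units `e_vw = e_vv J e_ww` (`DoubleSubalgebra.eq_top_of_diagonalSetoid`).

Random graphs have no such partition by the first moment method. Fix a partition with `k < n` cells,
a set `R` of representatives and the map `r` from vertices to representatives. For `v ∉ R` and
`c ∈ R`, comparing the neighbours of `v` and of `r v` in the cell of `c` gives a linear equation for
the adjacency matrix. Up to a loss of one equation for every pair of cells with more than one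
element, the `k (n - k)` equations determine the edges between `R` and its complement from the other
edges (`SimpleGraph.eq_zero_of_equitable`). Only the fact that `0 ≠ 1` in `F` matters here, so the
characteristic plays no role. There are at most `(n choose k) k ^ (n - k)` pairs `(R, r)` with `k`
representatives, and the expected number of equitable ones among them is at most `1 / n ^ 2` for
large `n`, uniformly in `k` (`choose_mul_pow_mul_sq_le`), so that the sum over `k` tends to zero.
-/

/-! ### The diagonal part of a double subalgebra -/

namespace DoubleSubalgebra

variable {F V : Type*} [Field F] [Fintype V] [DecidableEq V]

/-- The vectors `x` for which the diagonal matrix with diagonal `x` belongs to the double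
subalgebra, as a subalgebra of the functions on the vertices. -/
def diagonalPart (S : DoubleSubalgebra F V) : Subalgebra F (V → F) :=
  S.toSubalgebra.comap (Matrix.diagonalAlgHom F)

theorem mem_diagonalPart {S : DoubleSubalgebra F V} {x : V → F} :
    x ∈ S.diagonalPart ↔ Matrix.diagonal x ∈ S.toSubalgebra := Iff.rfl

theorem mulVec_mem_diagonalPart {S : DoubleSubalgebra F V} {A : Matrix V V F}
    (hA : A ∈ S.toSubalgebra) {x : V → F} (hx : x ∈ S.diagonalPart) :
    A.mulVec x ∈ S.diagonalPart := by
  have h : Matrix.diagonal (A.mulVec x) =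
      1 ⊙ (A * Matrix.diagonal x * Matrix.of fun _ _ => 1) := by
    ext i j
    by_cases hij : i = j
    · subst hij
      simp [Matrix.mul_apply, Matrix.mulVec, dotProduct, Matrix.diagonal_apply]
    · simp [hij]
  rw [mem_diagonalPart, h]
  exact S.hadamard_mem' (one_mem S.toSubalgebra)
    (mul_mem (mul_mem hA (mem_diagonalPart.1 hx)) S.allOne_mem')

/-- Two vertices are equivalent if no element of the diagonal part separates them. -/
def diagonalSetoid (S : DoubleSubalgebra F V) : Setoid V where
  r u v := ∀ x ∈ S.diagonalPart, x u = x v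
  iseqv := ⟨fun _ _ _ => rfl, fun h x hx => (h x hx).symm,
    fun h h' x hx => (h x hx).trans (h' x hx)⟩

open scoped Classical in
/-- By interpolation, the diagonal part contains the indicators of the classes of vertices which it
does not separate. -/
theorem indicator_mem_diagonalPart (S : DoubleSubalgebra F V) (c : V) :
    (fun w => if S.diagonalSetoid w c then (1 : F) else 0) ∈ S.diagonalPart := by
  have hex : ∀ w, ∃ x ∈ S.diagonalPart, (S.diagonalSetoid w c → x = 1) ∧
      (¬ S.diagonalSetoid w c → x c = 1 ∧ x w = 0) := by
    intro w
    by_cases hw : S.diagonalSetoid w c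
    · exact ⟨1, one_mem _, fun _ => rfl, fun h => absurd hw h⟩
    · have h : ∃ x ∈ S.diagonalPart, x w ≠ x c := by
        by_contra! hcon
        exact hw hcon
      obtain ⟨x, hx, hne⟩ := h
      refine ⟨(x c - x w)⁻¹ • (x - algebraMap F (V → F) (x w)),
        Subalgebra.smul_mem _ (sub_mem hx (Subalgebra.algebraMap_mem _ _)) _,
        fun h => absurd h hw, fun _ => ⟨?_, ?_⟩⟩
      · simpa using inv_mul_cancel₀ (sub_ne_zero.2 hne.symm)
      · simp
  choose x hx hx1 hx0 using hex
  convert prod_mem (S := S.diagonalPart) (t := Finset.univ) (f := x) fun w _ => hx w using 1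
  funext w
  rw [Finset.prod_apply]
  split_ifs with hw
  · refine (Finset.prod_eq_one fun u _ => ?_).symm
    by_cases hu : S.diagonalSetoid u c
    · simp [hx1 u hu]
    · rw [hw (x u) (hx u), (hx0 u hu).1]
  · exact (Finset.prod_eq_zero (f := fun u => x u w) (Finset.mem_univ w) (hx0 w hw).2).symm

/-- If the diagonal part separates all vertices, it contains the diagonal matrix units, and these
yield the other matrix units by multiplying the all-one matrix on both sides. -/
theorem eq_top_of_diagonalSetoid (S : DoubleSubalgebra F V)
    (h : ∀ u v, S.diagonalSetoid u v → u = v) : S.toSubalgebra = ⊤ := by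
  classical
  have hd : ∀ c, Matrix.diagonal (Pi.single c (1 : F)) ∈ S.toSubalgebra := by
    intro c
    rw [← mem_diagonalPart]
    convert S.indicator_mem_diagonalPart c using 1
    ext w
    have : S.diagonalSetoid w c ↔ w = c := ⟨h w c, fun e => e ▸ S.diagonalSetoid.refl w⟩
    simp [this, Pi.single_apply]
  rw [eq_top_iff]
  intro M _
  rw [Matrix.matrix_eq_sum_single M]
  refine sum_mem fun i _ => sum_mem fun j _ => ?_
  have hs : Matrix.single i j (M i j) = M i j • (Matrix.diagonal (Pi.single i (1 : F)) *
      (Matrix.of fun _ _ => 1) * Matrix.diagonal (Pi.single j (1 : F))) := by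
    ext a b
    simp [Matrix.single_apply, Pi.single_apply, Matrix.diagonal_mul, Matrix.mul_diagonal]
    grind
  rw [hs]
  exact Subalgebra.smul_mem _ (mul_mem (mul_mem (hd i) S.allOne_mem') (hd j)) _

end DoubleSubalgebra

/-! ### Equitable partitions -/

namespace SimpleGraph

open scoped Classical in
/-- The fibres of `r` form an equitable partition of `G` with degrees counted in `F`. The partition
is encoded by a map `r` which sends every vertex to a chosen representative of its cell: `v` and
`r v` have, as elements of `F`, the same number of neighbours in each cell. -/
def IsEquitable (F : Type*) {V : Type*} [Field F] [Fintype V] [DecidableEq V]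
    (G : SimpleGraph V) (r : V → V) : Prop :=
  ∀ v c, ∑ w with r w = c, G.adjMatrix F v w = ∑ w with r w = c, G.adjMatrix F (r v) w

/-- The maps which fix `R` and send all other vertices into `R`: the ways to assign the vertices to
cells represented by the elements of `R`. -/
def retractions {V : Type*} [Fintype V] [DecidableEq V] (R : Finset V) : Finset (V → V) :=
  Fintype.piFinset fun v => if v ∈ R then {v} else R

section Retractions

variable {V : Type*} [Fintype V] [DecidableEq V] {R : Finset V} {r : V → V}

theorem mem_retractions : r ∈ retractions R ↔ (∀ v, r v ∈ R) ∧ ∀ v ∈ R, r v = v := by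
  simp only [retractions, Fintype.mem_piFinset]
  refine ⟨fun h => ⟨fun v => ?_, fun v hv => by simpa [hv] using h v⟩, fun h v => ?_⟩
  · by_cases hv : v ∈ R
    · have := h v
      simp_all
    · simpa [hv] using h v
  · by_cases hv : v ∈ R
    · simp [hv, h.2 v hv]
    · simpa [hv] using h.1 v

theorem card_retractions (R : Finset V) :
    (retractions R).card = R.card ^ (Fintype.card V - R.card) := by
  rw [retractions, Fintype.card_piFinset, ← Finset.card_compl,
    ← Finset.prod_const, ← Finset.prod_subset (Finset.subset_univ Rᶜ)]
  · exact Finset.prod_congr rfl fun v hv => by simp [Finset.mem_compl.1 hv]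
  · intro v _ hv
    have hv' : v ∈ R := by simpa using hv
    simp [hv']

end Retractions

/-- The classes of vertices which the double algebra does not separate form an equitable partition,
since the diagonal part is closed under multiplication by the adjacency matrix. -/
theorem exists_isEquitable (F : Type*) {V : Type*} [Field F] [Fintype V] [DecidableEq V]
    (G : SimpleGraph V) (h : (G.doubleAlgebra F).toSubalgebra ≠ ⊤) :
    ∃ R : Finset V, R ≠ Finset.univ ∧ ∃ r ∈ retractions R, G.IsEquitable F r := by
  classical
  set S := G.doubleAlgebra F with hS
  let r : V → V := fun v => (Quotient.mk S.diagonalSetoid v).out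
  have hr : ∀ v, S.diagonalSetoid (r v) v := fun v => Quotient.mk_out (s := S.diagonalSetoid) v
  have hrr : ∀ u v, S.diagonalSetoid u v → r u = r v := fun u v huv =>
    congrArg Quotient.out (Quotient.sound (s := S.diagonalSetoid) huv)
  have hrep : ∀ v ∈ Finset.univ.image r, r v = v := by
    intro v hv
    obtain ⟨u, -, rfl⟩ := Finset.mem_image.1 hv
    exact hrr _ _ (hr u)
  refine ⟨Finset.univ.image r, fun hR => h ?_, r, mem_retractions.2 ⟨by simp, hrep⟩, ?_⟩
  · refine S.eq_top_of_diagonalSetoid fun u v huv => ?_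
    rw [← hrep u (by simp [hR]), ← hrep v (by simp [hR]), hrr u v huv]
  · intro v c
    by_cases hc : r c = c
    · have hA : G.adjMatrix F ∈ S.toSubalgebra := DoubleSubalgebra.self_mem_adjoin _
      have key := hr v _ (DoubleSubalgebra.mulVec_mem_diagonalPart hA
        (S.indicator_mem_diagonalPart c))
      have hiff : ∀ w, S.diagonalSetoid w c ↔ r w = c := fun w =>
        ⟨fun hw => (hrr w c hw).trans hc, fun hw => S.diagonalSetoid.symm (hw ▸ hr w)⟩
      simp only [Matrix.mulVec, dotProduct, mul_ite, mul_one, mul_zero, hiff] at key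
      rw [Finset.sum_filter, Finset.sum_filter]
      exact key.symm
    · rw [Finset.filter_false_of_mem]
      · simp
      · rintro w - rfl
        exact hc (hrr _ _ (hr w))

/-! ### Counting graphs with a given equitable partition -/

section Counting

variable {V : Type*} [Fintype V] [LinearOrder V] {R : Finset V} {r : V → V}

/-- The cells, given by their representatives, which have more than one element. -/
def nontrivialCells (R : Finset V) (r : V → V) : Finset V := Rᶜ.image r

/-- The pairs `(v, c)` of a vertex outside `R` and a representative for which equitability does not
determine the adjacency of `v` and `c` from the other edges. For two (possibly equal) cells with more
than one element, the equations between them may have rank one less than their number, so that one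
pair has to be given up; it is chosen with `v` least in its cell apart from the representative. -/
def exceptionalPairs (R : Finset V) (r : V → V) : Finset (V × V) :=
  {p ∈ Rᶜ ×ˢ R | (∀ w ∈ Rᶜ, r w = r p.1 → p.1 ≤ w) ∧ r p.1 ≤ p.2 ∧ p.2 ∈ nontrivialCells R r}

/-- The pairs `(v, c)` of a vertex outside `R` and a representative for which equitability
determines the adjacency of `v` and `c` from the edges that do not come from such pairs. -/
def pivotPairs (R : Finset V) (r : V → V) : Finset (V × V) :=
  (Rᶜ ×ˢ R) \ exceptionalPairs R r

/-- The unordered version of `pivotPairs`. -/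
def pivotEdges (R : Finset V) (r : V → V) : Finset (Sym2 V) :=
  (pivotPairs R r).image fun p => s(p.1, p.2)

theorem card_pivotEdges (R : Finset V) (r : V → V) :
    (pivotEdges R r).card = (pivotPairs R r).card := by
  refine Finset.card_image_of_injOn ?_
  rintro ⟨v, c⟩ h ⟨v', c'⟩ h' heq
  simp only [pivotPairs, Finset.coe_sdiff, Set.mem_sdiff, Finset.mem_coe, Finset.mem_product,
    Finset.mem_compl] at h h'
  rcases Sym2.eq_iff.1 heq with ⟨h1, h2⟩ | ⟨h1, h2⟩
  · exact Prod.ext h1 h2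
  · simp only at h1
    exact absurd (h1 ▸ h'.1.2) h.1.1

theorem card_exceptionalPairs_le (R : Finset V) (r : V → V) :
    (exceptionalPairs R r).card ≤ ((nontrivialCells R r).card + 1).choose 2 := by
  rw [← Finset.card_sym2]
  refine Finset.card_le_card_of_injOn (fun p => s(r p.1, p.2)) ?_ ?_
  · rintro ⟨v, c⟩ h
    simp only [exceptionalPairs, Finset.coe_filter, Set.mem_ofPred_eq, Finset.mem_product] at h
    simp only [Finset.mem_coe, Finset.mk_mem_sym2_iff]
    exact ⟨Finset.mem_image_of_mem _ h.1.1, h.2.2.2⟩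
  · rintro ⟨v, c⟩ h ⟨v', c'⟩ h' heq
    simp only [exceptionalPairs, Finset.coe_filter, Set.mem_ofPred_eq, Finset.mem_product] at h h'
    have h12 : r v = r v' ∧ c = c' := by
      rcases Sym2.eq_iff.1 heq with h1 | ⟨h1, h2⟩
      · exact h1
      · -- The order forces both pairs onto the diagonal.
        have := h.2.2.1
        have := h'.2.2.1
        simp only at *
        exact ⟨by order, by order⟩
    exact Prod.ext (le_antisymm (h.2.1 _ h'.1.1 h12.1.symm) (h'.2.1 _ h.1.1 h12.1)) h12.2

theorem card_pivotEdges_bounds (hr : r ∈ retractions R) :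
    (Fintype.card V - R.card) * R.card ≤
        2 * (pivotEdges R r).card + (Fintype.card V - R.card) ∧
      (Fintype.card V - R.card) * R.card ≤ (pivotEdges R r).card + R.card * (R.card + 1) := by
  set m := (nontrivialCells R r).card
  have hmj : m ≤ Fintype.card V - R.card := by
    rw [← Finset.card_compl]
    exact Finset.card_image_le
  have hmk : m ≤ R.card := Finset.card_le_card <| Finset.image_subset_iff.2
    fun v _ => (mem_retractions.1 hr).1 v
  have hQ : (Fintype.card V - R.card) * R.card ≤
      (pivotEdges R r).card + (exceptionalPairs R r).card := by
    rw [card_pivotEdges, ← Finset.card_compl, ← Finset.card_product, pivotPairs]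
    have := Finset.le_card_sdiff (exceptionalPairs R r) (Rᶜ ×ˢ R)
    omega
  have hD := card_exceptionalPairs_le R r
  have hm : 2 * (m + 1).choose 2 = m * (m + 1) := by
    rw [Nat.choose_two_right, Nat.mul_div_cancel' (Nat.even_mul_pred_self _).two_dvd,
      Nat.add_sub_cancel, mul_comm]
  have h1 : m * (m + 1) ≤ (Fintype.card V - R.card) * (R.card + 1) := by gcongr
  have h2 : m * (m + 1) ≤ R.card * (R.card + 1) := by gcongr
  constructor <;> nlinarith

/-- The linear system behind the count: if `d` is the difference of two solutions which agree
outside the pivot pairs, then `d v c` for `v ∉ R` and `c ∈ R` depends only on the cell of `v`. It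
vanishes for the exceptional pairs, hence whenever `r v ≤ c`, and then also for `c < r v`, by
the equation between the same cells in the other direction. -/
theorem eq_zero_of_equitable {F : Type*} [Field F] (hr : r ∈ retractions R) {d : V → V → F}
    (hsymm : ∀ v w, d v w = d w v)
    (hd : ∀ v c, ∑ w with r w = c, d v w = ∑ w with r w = c, d (r v) w)
    (hpiv : ∀ v w, s(v, w) ∉ pivotEdges R r → d v w = 0) : d = 0 := by
  obtain ⟨hrR, hrid⟩ := mem_retractions.1 hr
  have hin : ∀ v ∈ R, ∀ w ∈ R, d v w = 0 := by
    intro v hv w hw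
    refine hpiv v w fun h => ?_
    simp only [pivotEdges, pivotPairs, Finset.mem_image, Finset.mem_sdiff, Finset.mem_product,
      Finset.mem_compl] at h
    obtain ⟨p, ⟨⟨hp, -⟩, -⟩, heq⟩ := h
    rcases Sym2.eq_iff.1 heq with h | h
    · exact hp (h.1 ▸ hv)
    · exact hp (h.1 ▸ hw)
  have hout : ∀ v ∉ R, ∀ w ∉ R, d v w = 0 := by
    intro v hv w hw
    refine hpiv v w fun h => ?_
    simp only [pivotEdges, pivotPairs, Finset.mem_image, Finset.mem_sdiff, Finset.mem_product,
      Finset.mem_compl] at h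
    obtain ⟨p, ⟨⟨-, hp⟩, -⟩, heq⟩ := h
    rcases Sym2.eq_iff.1 heq with h | h
    · exact hw (h.2 ▸ hp)
    · exact hv (h.2 ▸ hp)
  have hexc : ∀ v c, (v, c) ∈ exceptionalPairs R r → d v c = 0 := by
    intro v c hvc
    refine hpiv v c fun h => ?_
    have hvc' := hvc
    simp only [exceptionalPairs, Finset.mem_filter, Finset.mem_product,
      Finset.mem_compl] at hvc'
    simp only [pivotEdges, pivotPairs, Finset.mem_image, Finset.mem_sdiff, Finset.mem_product,
      Finset.mem_compl] at h
    obtain ⟨⟨p, q⟩, ⟨⟨hp, -⟩, hn⟩, heq⟩ := h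
    rcases Sym2.eq_iff.1 heq with ⟨h1, h2⟩ | ⟨h1, h2⟩
    · simp only at h1 h2
      subst h1 h2
      exact hn hvc
    · exact hp (h1 ▸ hvc'.1.2)
  have heqn : ∀ v ∉ R, ∀ c ∈ R, d v c = ∑ w ∈ Rᶜ with r w = c, d w (r v) := by
    intro v hv c hc
    have h1 : ∑ w with r w = c, d v w = d v c := by
      refine Finset.sum_eq_single_of_mem c (by simp [hrid c hc]) fun w hw hwc => ?_
      refine hout v hv w fun hwR => hwc ?_
      rw [← hrid w hwR, (Finset.mem_filter.1 hw).2]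
    have h2 : ∑ w with r w = c, d (r v) w = ∑ w ∈ Rᶜ with r w = c, d w (r v) := by
      rw [Finset.sum_congr rfl fun w _ => hsymm (r v) w]
      refine (Finset.sum_subset (Finset.filter_subset_filter _ (Finset.subset_univ _))
        fun w hw hw' => ?_).symm
      refine hin w ?_ _ (hrR v)
      simpa [(Finset.mem_filter.1 hw).2] using hw'
    rw [← h1, hd, h2]
  have hle : ∀ v ∉ R, ∀ c ∈ nontrivialCells R r, r v ≤ c → d v c = 0 := by
    intro v hv c hc hvc
    have hcR : c ∈ R := by
      obtain ⟨w, -, rfl⟩ := Finset.mem_image.1 hc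
      exact hrR w
    obtain ⟨u, hu, humin⟩ := Finset.exists_min_image ({w ∈ Rᶜ | r w = r v}) id
      ⟨v, by simpa using hv⟩
    simp only [Finset.mem_filter, Finset.mem_compl, id] at hu humin
    rw [heqn v hv c hcR, ← hu.2, ← heqn u hu.1 c hcR]
    refine hexc u c ?_
    simp only [exceptionalPairs, Finset.mem_filter, Finset.mem_product, Finset.mem_compl]
    exact ⟨⟨hu.1, hcR⟩, fun w hw hwu => humin w ⟨hw, hwu.trans hu.2⟩, hu.2 ▸ hvc, hc⟩
  have hmix : ∀ v ∉ R, ∀ c ∈ R, d v c = 0 := by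
    intro v hv c hc
    by_cases hvc : r v ≤ c ∧ c ∈ nontrivialCells R r
    · exact hle v hv c hvc.2 hvc.1
    rw [heqn v hv c hc]
    refine Finset.sum_eq_zero fun w hw => ?_
    obtain ⟨hwR, rfl⟩ := Finset.mem_filter.1 hw
    have hlt : r w ≤ r v := by
      by_contra! hlt
      exact hvc ⟨hlt.le, Finset.mem_image_of_mem r hwR⟩
    exact hle w (Finset.mem_compl.1 hwR) _
      (Finset.mem_image_of_mem r (Finset.mem_compl.2 hv)) hlt
  ext v w
  by_cases hv : v ∈ R <;> by_cases hw : w ∈ R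
  · exact hin v hv w hw
  · rw [hsymm]
    exact hmix w hw v hv
  · exact hmix v hv w hw
  · exact hout v hv w hw

/-- A graph with a given equitable partition is determined by its edges which are not pivots. -/
theorem IsEquitable.eq_of_edgeSet_sdiff {F : Type*} [Field F] (hr : r ∈ retractions R)
    {G H : SimpleGraph V} (hG : G.IsEquitable F r) (hH : H.IsEquitable F r)
    (h : G.edgeSet \ pivotEdges R r = H.edgeSet \ pivotEdges R r) : G = H := by
  classical
  have hd : (fun v w => G.adjMatrix F v w - H.adjMatrix F v w) = 0 := by
    refine eq_zero_of_equitable hr (fun v w => ?_) (fun v c => ?_) (fun v w hvw => ?_)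
    · simp [adj_comm]
    · have hGv := hG v c
      have hHv := hH v c
      simp only [Finset.sum_sub_distrib]
      convert congrArg₂ (· - ·) hGv hHv
    · have : G.Adj v w ↔ H.Adj v w := by
        have := Set.ext_iff.1 h s(v, w)
        simpa [hvw] using this
      simp [this]
  ext v w
  have hvw := congrFun (congrFun hd v) w
  simp only [adjMatrix_apply, Pi.zero_apply] at hvw
  by_cases h1 : G.Adj v w <;> by_cases h2 : H.Adj v w <;> simp_all

theorem ncard_isEquitable_mul_le (F : Type*) [Field F] (hr : r ∈ retractions R) :
    {G : SimpleGraph V | G.IsEquitable F r}.ncard * 2 ^ (pivotEdges R r).card ≤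
      2 ^ (Fintype.card V).choose 2 := by
  classical
  set E : Finset (Sym2 V) := Sym2.diagSetᶜ.toFinset with hE
  have hEcard : E.card = (Fintype.card V).choose 2 := by
    rw [hE, Set.toFinset_card, Sym2.card_diagSet_compl]
  have hsub : pivotEdges R r ⊆ E := by
    intro e he
    obtain ⟨p, hp, rfl⟩ := Finset.mem_image.1 he
    simp only [pivotPairs, Finset.mem_sdiff, Finset.mem_product, Finset.mem_compl] at hp
    simp only [hE, Set.mem_toFinset, Set.mem_compl_iff, Sym2.mem_diagSet, Sym2.mk_isDiag_iff]
    exact fun h => hp.1.1 (h ▸ hp.1.2)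
  have hle : {G : SimpleGraph V | G.IsEquitable F r}.ncard ≤
      ((E \ pivotEdges R r).powerset : Set (Finset (Sym2 V))).ncard := by
    refine Set.ncard_le_ncard_of_injOn (fun G => G.edgeSet.toFinset \ pivotEdges R r) ?_ ?_
    · intro G _
      simp only [Finset.coe_powerset, Set.mem_preimage, Set.mem_powerset_iff, Finset.coe_subset]
      refine Finset.sdiff_subset_sdiff (fun e he => ?_) le_rfl
      simp only [hE, Set.mem_toFinset, Set.mem_compl_iff, Sym2.mem_diagSet] at he ⊢
      exact G.not_isDiag_of_mem_edgeSet he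
    · intro G hG H hH h
      refine IsEquitable.eq_of_edgeSet_sdiff hr hG hH ?_
      simpa using congrArg (fun s : Finset (Sym2 V) => (s : Set (Sym2 V))) h
  rw [Set.ncard_coe_finset, Finset.card_powerset, Finset.card_sdiff_of_subset hsub, hEcard] at hle
  calc _ ≤ _ := Nat.mul_le_mul_right _ hle
    _ = _ := by
      rw [← pow_add, Nat.sub_add_cancel (hEcard ▸ Finset.card_le_card hsub)]

end Counting

end SimpleGraph

/-! ### Numerical estimates -/

theorem ninety_mul_sq_le_two_pow {L : ℕ} (hL : 16 ≤ L) : 90 * L ^ 2 ≤ 2 ^ (L - 1) := by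
  induction L, hL using Nat.le_induction with
  | base => norm_num
  | succ L hL ih =>
    obtain ⟨M, rfl⟩ : ∃ M, L = M + 1 := ⟨L - 1, by omega⟩
    simp only [Nat.add_sub_cancel] at ih ⊢
    rw [pow_succ 2 M]
    nlinarith

/-- The bound on the number of choices of `k` representatives and of the cells, against the number
`q` of binary constraints. With `L` the logarithm of `n`, the first bound on `q` suffices if
`8 * L < k`, and the second one if `k ≤ 8 * L`. -/
theorem choose_mul_pow_mul_sq_le {n k q : ℕ} (hn : 2 ^ 16 ≤ n) (hk : k < n)
    (h1 : (n - k) * k ≤ 2 * q + (n - k)) (h2 : (n - k) * k ≤ q + k * (k + 1)) :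
    n.choose k * k ^ (n - k) * n ^ 2 ≤ 2 ^ q := by
  obtain rfl | hk0 := Nat.eq_zero_or_pos k
  · simp [zero_pow (by omega : n ≠ 0)]
  set L := Nat.clog 2 n
  have hnL : n ≤ 2 ^ L := Nat.le_pow_clog one_lt_two n
  have hL : 16 ≤ L := by
    have := hn.trans hnL
    exact (Nat.pow_le_pow_iff_right one_lt_two).1 this
  obtain ⟨j, rfl⟩ : ∃ j, n = k + j := ⟨n - k, by omega⟩
  have hj : 1 ≤ j := by omega
  simp only [Nat.add_sub_cancel_left] at h1 h2 ⊢
  obtain hkL | hkL := lt_or_ge (8 * L) k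
  · calc (k + j).choose k * k ^ j * (k + j) ^ 2
        ≤ (2 ^ L) ^ j * (2 ^ L) ^ j * (2 ^ L) ^ (2 * j) := by
          gcongr
          · rw [Nat.choose_symm_add]
            exact (Nat.choose_le_pow _ _).trans (by gcongr)
          · omega
          · exact Nat.one_le_two_pow
          · omega
      _ = 2 ^ (4 * L * j) := by ring
      _ ≤ 2 ^ q := by
          refine Nat.pow_le_pow_right two_pos ?_
          nlinarith
  · have hlt : 2 ^ (L - 1) < k + j := Nat.pow_pred_clog_lt_self one_lt_two (by omega)
    have hbig := (ninety_mul_sq_le_two_pow hL).trans hlt.le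
    have hk2 : k ≤ 2 ^ (k - 1) := by
      have := Nat.lt_two_pow_self (n := k - 1)
      omega
    calc (k + j).choose k * k ^ j * (k + j) ^ 2
        ≤ (2 ^ L) ^ k * (2 ^ (k - 1)) ^ j * (2 ^ L) ^ 2 := by
          gcongr
          exact (Nat.choose_le_pow _ _).trans (by gcongr)
      _ = 2 ^ (L * k + (k - 1) * j + L * 2) := by simp only [← pow_mul, pow_add]
      _ ≤ 2 ^ q := by
          refine Nat.pow_le_pow_right two_pos ?_
          obtain ⟨m, rfl⟩ : ∃ m, k = m + 1 := ⟨k - 1, by omega⟩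
          simp only [Nat.add_sub_cancel]
          have hsq : (m + 1) ^ 2 ≤ (8 * L) ^ 2 := by gcongr
          have hLk : L * (m + 1) ≤ L * (8 * L) := by gcongr
          nlinarith

/-! ### The random graph -/

namespace SimpleGraph

/-- For edge probability one half, the random graph is uniformly distributed. -/
theorem binomialRandom_half_apply {V : Type*} [Fintype V] {p : unitInterval} (hp : (p : ℝ) = 1 / 2)
    (s : Set (SimpleGraph V)) :
    (binomialRandom V p).real s = s.ncard * ((2 : ℝ) ^ (Fintype.card V).choose 2)⁻¹ := by
  classical
  have hsing : ∀ G : SimpleGraph V,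
      (binomialRandom V p).real {G} = ((2 : ℝ) ^ (Fintype.card V).choose 2)⁻¹ := by
    intro G
    have hle : G.edgeSet.ncard ≤ (Fintype.card V).choose 2 := by
      rw [← coe_edgeFinset, Set.ncard_coe_finset]
      exact G.card_edgeFinset_le_card_choose_two
    simp only [MeasureTheory.measureReal_def, binomialRandom_singleton, ENNReal.toReal_mul,
      ENNReal.toReal_pow, ENNReal.coe_toReal, unitInterval.coe_toNNReal,
      unitInterval.coe_symm_eq, hp, Nat.card_eq_fintype_card]
    rw [show (1 : ℝ) - 1 / 2 = 1 / 2 by norm_num, ← pow_add, Nat.add_sub_cancel' hle]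
    simp
  have : MeasurableSingletonClass (SimpleGraph V) := ⟨fun G => by
    rw [← measurableEmbedding_edgeSet.measurableSet_image]
    exact (Set.toFinite _).measurableSet⟩
  rw [← Set.coe_toFinset s, ← MeasureTheory.sum_measureReal_singleton, Set.ncard_coe_finset]
  simp [hsing]

/-- The probability that the random graph has a nontrivial partition which is equitable over `F`
tends to zero, by the first moment method. -/
theorem binomialRandom_exists_isEquitable_le (F : Type*) [Field F] {p : unitInterval}
    (hp : (p : ℝ) = 1 / 2) {n : ℕ} (hn : 2 ^ 16 ≤ n) :
    (binomialRandom (Fin n) p).real {G | ∃ R : Finset (Fin n), R ≠ Finset.univ ∧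
      ∃ r ∈ retractions R, G.IsEquitable F r} ≤ 1 / n := by
  have hn0 : (0 : ℝ) < n := by
    have : 0 < n := by omega
    exact_mod_cast this
  let f : ℕ → ℝ := fun k => if k < n then ((n.choose k : ℝ) * n ^ 2)⁻¹ else 0
  have hR : ∀ R : Finset (Fin n), R ≠ Finset.univ →
      (binomialRandom (Fin n) p).real {G | ∃ r ∈ retractions R, G.IsEquitable F r} ≤
        f R.card := by
    intro R hR
    have hlt : R.card < n := by
      simpa using (Finset.card_lt_iff_ne_univ R).2 hR
    have hunion : {G : SimpleGraph (Fin n) | ∃ r ∈ retractions R, G.IsEquitable F r} =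
        ⋃ r ∈ retractions R, {G | G.IsEquitable F r} := by
      ext G
      simp
    have hchoose : (0 : ℝ) < n.choose R.card := by exact_mod_cast Nat.choose_pos hlt.le
    have hr : ∀ r ∈ retractions R, (binomialRandom (Fin n) p).real {G | G.IsEquitable F r} ≤
        ((n.choose R.card : ℝ) * R.card ^ (n - R.card) * n ^ 2)⁻¹ := by
      intro r hr
      have hRpos : 0 < R.card := Finset.card_pos.2
        ⟨_, (mem_retractions.1 hr).1 ⟨0, by omega⟩⟩
      have hRpos' : (0 : ℝ) < R.card := by exact_mod_cast hRpos
      obtain ⟨h1, h2⟩ := card_pivotEdges_bounds hr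
      rw [Fintype.card_fin] at h1 h2
      have hnum := choose_mul_pow_mul_sq_le hn hlt h1 h2
      have hcount := ncard_isEquitable_mul_le F hr
      have hnum' : (n.choose R.card : ℝ) * R.card ^ (n - R.card) * n ^ 2 ≤
          2 ^ (pivotEdges R r).card := by exact_mod_cast hnum
      have hcount' : ({G : SimpleGraph (Fin n) | G.IsEquitable F r}.ncard : ℝ) *
          2 ^ (pivotEdges R r).card ≤ 2 ^ (Fintype.card (Fin n)).choose 2 := by
        exact_mod_cast hcount
      rw [binomialRandom_half_apply hp]
      refine le_trans ?_ (inv_anti₀ (by positivity) hnum')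
      rw [mul_inv_le_iff₀ (by positivity), inv_mul_eq_div, le_div_iff₀ (by positivity)]
      exact hcount'
    rw [hunion]
    refine (MeasureTheory.measureReal_biUnion_finset_le _ _).trans
      ((Finset.sum_le_sum hr).trans ?_)
    simp only [Finset.sum_const, card_retractions, Fintype.card_fin, nsmul_eq_mul, f, if_pos hlt]
    obtain h0 | hRpos := Nat.eq_zero_or_pos R.card
    · simp only [h0, Nat.sub_zero]
      rw [zero_pow (by omega : n ≠ 0)]
      simp
    · have hRpos' : (0 : ℝ) < R.card := by exact_mod_cast hRpos
      push_cast
      exact le_of_eq (by field_simp)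
  have hunion : {G : SimpleGraph (Fin n) | ∃ R : Finset (Fin n), R ≠ Finset.univ ∧
      ∃ r ∈ retractions R, G.IsEquitable F r} =
      ⋃ R ∈ Finset.univ.erase (Finset.univ : Finset (Fin n)),
        {G | ∃ r ∈ retractions R, G.IsEquitable F r} := by
    ext G
    simp
  have hf : ∀ k, 0 ≤ f k := fun k => by
    simp only [f]
    split_ifs <;> positivity
  rw [hunion]
  calc _ ≤ ∑ R ∈ Finset.univ.erase (Finset.univ : Finset (Fin n)), f R.card :=
        (MeasureTheory.measureReal_biUnion_finset_le _ _).trans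
          (Finset.sum_le_sum fun R h => hR R (Finset.ne_of_mem_erase h))
    _ ≤ ∑ R ∈ (Finset.univ : Finset (Fin n)).powerset, f R.card :=
        Finset.sum_le_sum_of_subset_of_nonneg (by simp) fun R _ _ => hf _
    _ = ∑ k ∈ Finset.range (n + 1), n.choose k • f k := by
        rw [Finset.sum_powerset_apply_card, Finset.card_univ, Fintype.card_fin]
    _ = ∑ k ∈ Finset.range n, ((n : ℝ) ^ 2)⁻¹ := by
        rw [Finset.sum_range_succ]
        simp only [f, lt_irrefl, if_false, smul_zero, add_zero]
        refine Finset.sum_congr rfl fun k hk => ?_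
        have hk' := Finset.mem_range.1 hk
        have : (0 : ℝ) < n.choose k := by exact_mod_cast Nat.choose_pos hk'.le
        rw [if_pos hk', nsmul_eq_mul]
        field_simp
    _ = 1 / n := by
        rw [Finset.sum_const, Finset.card_range, nsmul_eq_mul]
        field_simp

end SimpleGraph

theorem theorem1p3 (F : Type*) [Field F] :
    Filter.Tendsto
      (fun n : ℕ =>
        SimpleGraph.binomialRandom (Fin n) ⟨1 / 2, by norm_num, by norm_num⟩
          {G : SimpleGraph (Fin n) | (G.doubleAlgebra F).toSubalgebra = ⊤})
      Filter.atTop (nhds 1) := by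
  set p : unitInterval := ⟨1 / 2, by norm_num, by norm_num⟩
  have hlim : Filter.Tendsto (fun n : ℕ => ENNReal.ofReal (1 - 1 / (n : ℝ)))
      Filter.atTop (nhds 1) := by
    have := ENNReal.tendsto_ofReal (tendsto_one_div_atTop_nhds_zero_nat (𝕜 := ℝ) |>.const_sub 1)
    simpa using this
  refine tendsto_of_tendsto_of_tendsto_of_le_of_le' hlim tendsto_const_nhds ?_
    (Filter.Eventually.of_forall fun n => MeasureTheory.prob_le_one)
  filter_upwards [Filter.eventually_ge_atTop (2 ^ 16)] with n hn
  rw [← MeasureTheory.ofReal_measureReal]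
  refine ENNReal.ofReal_le_ofReal ?_
  set good := {G : SimpleGraph (Fin n) | (G.doubleAlgebra F).toSubalgebra = ⊤}
  have hbad : (SimpleGraph.binomialRandom (Fin n) p).real goodᶜ ≤ 1 / n :=
    (MeasureTheory.measureReal_mono fun G hG => G.exists_isEquitable F hG).trans
      (SimpleGraph.binomialRandom_exists_isEquitable_le F rfl hn)
  have hunion := MeasureTheory.measureReal_union_le
    (μ := SimpleGraph.binomialRandom (Fin n) p) good goodᶜ
  rw [Set.union_compl_self, MeasureTheory.probReal_univ] at hunion
  linarith
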